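/- Let $\mathcal X$ be a Banach space and $\mathcal C\subset\mathcal X$ a closed convex cone with $\mathcal C\cap(-\mathcal C)=\{0\}$ and interior $\mathcal C_0$. Write $x\le y$ if $y-x\in\mathcal C$. For $x,y\in\mathcal C_0$ let $d_T(x,y)=\log\max\{M(x/y),M(y/x)\}$, where $M(x/y)=\inf\{t\in\mathbb R: x\le ty\}$ (Thompson's part metric). Let $J=[0,T)$ with $0<T\le+\infty$, and let $\phi:J\times\mathcal C_0\to\mathcal X$ be continuous and Fréchet differentiable in the second variable, with derivative $D\phi_t(x)$; assume that for every closed bounded set $K\subset\mathcal X$ with $K\subset\mathcal C_0$ there is a constant $L$ with $\|D\phi_t(x)\|\le L$ for all $t\in J$, $x\in K$. For $s\in J$ and $x\in\mathcal C_0$ let $t\mapsto M_s^t(x)$ be the maximal solution in $\mathcal C_0$, on a subinterval of $J$ starting at $s$, of $\dot x(t)=\phi(t,x(t))$, $x(s)=x$, and let $t_{\mathcal C_0}(s,x)\le T$ be the supremum of the times up to which it exists and stays in $\mathcal C_0$. Let $\alpha\in\mathbb R$. Suppose that the flow is order-preserving on $\mathcal C_0$: if $x_1,x_2\in\mathcal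 C_0$ and $x_1\ge x_2$, then $M_s^t(x_1)\ge M_s^t(x_2)$ whenever $0\le s\le t<\min\{t_{\mathcal C_0}(s,x_1),t_{\mathcal C_0}(s,x_2)\}$. Then the following are equivalent: (a) for all $x_1,x_2\in\mathcal C_0$, $d_T(M_s^t(x_1),M_s^t(x_2))\le e^{-\alpha(t-s)}d_T(x_1,x_2)$ whenever $0\le s\le t<\min\{t_{\mathcal C_0}(s,x_1),t_{\mathcal C_0}(s,x_2)\}$; (b) for all $s\in J$ and $x\in\mathcal C_0$, $D\phi_s(x)x-\phi(s,x)\le-\alpha x$. If either of these conditions holds and the cone $\mathcal C$ is normal (there is a constant $\gamma$ such that $0\le x\le y$ implies $\|x\|\le\gamma\|y\|$; this is automatic if $\dim\mathcal X<\infty$), then the flow leaves $\mathcal C_0$ invariant, i.e. $t_{\mathcal C_0}(s,x)=T$ for all $s\in J$ and $x\in\mathcal C_0$. -/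

import Mathlib

open Set

noncomputable section

namespace ConeFlow

variable {X : Type*} [NormedAddCommGroup X] [NormedSpace ℝ X]

/-- The order `x ≤ y ↔ y - x ∈ C` induced by the cone `C`. -/
def ConeLE (C : ProperCone ℝ X) (x y : X) : Prop := y - x ∈ C

/-- `C ∩ (-C) = {0}`. (A `ProperCone` is a closed convex cone containing `0`.) -/
def IsPointed (C : ProperCone ℝ X) : Prop :=
  (C : Set X) ∩ {x | -x ∈ C} = {0}

/-- `C` is a normal cone: `0 ≤ x ≤ y` implies `‖x‖ ≤ γ * ‖y‖`, with a constant `γ` independent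
of `x` and `y`. -/
def IsNormalCone (C : ProperCone ℝ X) : Prop :=
  ∃ γ : ℝ, ∀ x y : X, ConeLE C 0 x → ConeLE C x y → ‖x‖ ≤ γ * ‖y‖

/-- `C₀`, the interior of `C`. -/
def coneInterior (C : ProperCone ℝ X) : Set X := interior (C : Set X)

/-- `M(x/y) = inf {t ∈ ℝ : x ≤ t y}`. -/
def gaugeM (C : ProperCone ℝ X) (x y : X) : ℝ := sInf {t : ℝ | ConeLE C x (t • y)}

/-- Thompson's part metric `d_T(x,y) = log (max {M(x/y), M(y/x)})`, for `x, y ∈ C₀`. -/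
def thompsonDist (C : ProperCone ℝ X) (x y : X) : ℝ :=
  Real.log (max (gaugeM C x y) (gaugeM C y x))

/-- The time interval `J = [0,T)`, with `T` possibly `+∞`. -/
def timeInterval (T : EReal) : Set ℝ := {t : ℝ | 0 ≤ t ∧ (t : EReal) < T}

/-- `x` solves `ẋ(t) = φ(t, x(t))`, `x(s) = x₀` on `[s,b)`, with values in `D`. The derivative is
taken within `[s,∞)`, so it is two-sided for `t > s` and one-sided at `t = s`. (It is continuous
in `t` whenever `φ` is continuous on `[s,b) × D`.) -/
def IsSolution (φ : ℝ → X → X) (D : Set X) (s : ℝ) (x₀ : X) (b : EReal) (x : ℝ → X) : Prop :=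
  x s = x₀ ∧ ∀ t : ℝ, s ≤ t → (t : EReal) < b →
    x t ∈ D ∧ HasDerivWithinAt x (φ t (x t)) (Ici s) t

/-- The end `a` of the existence interval `[s,a) ⊆ [0,T)` of the maximal solution. -/
def maxTime (φ : ℝ → X → X) (D : Set X) (T : EReal) (s : ℝ) (x₀ : X) : EReal :=
  sSup {b : EReal | (s : EReal) < b ∧ b ≤ T ∧ ∃ x : ℝ → X, IsSolution φ D s x₀ b x}

open Classical in
/-- The flow `M_s^t(x₀)`: the value at time `t ∈ [s,a)` of the solution starting from `x₀` at time
`s`. The value for other `t` is immaterial. -/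
def flow (φ : ℝ → X → X) (D : Set X) (T : EReal) (s t : ℝ) (x₀ : X) : X :=
  if h : ∃ x : ℝ → X, ∃ b : EReal, (t : EReal) < b ∧ b ≤ T ∧ IsSolution φ D s x₀ b x then
    h.choose t
  else x₀

/-- `t_U(s,x₀) = sup {b ∈ (s,a) : M_s^t(x₀) ∈ U for all t ∈ [s,b)}`, the first time when the
trajectory leaves `U`. -/
def exitTime (φ : ℝ → X → X) (D : Set X) (T : EReal) (U : Set X) (s : ℝ) (x₀ : X) : EReal :=
  sSup {b : EReal | (s : EReal) < b ∧ b < maxTime φ D T s x₀ ∧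
    ∀ t : ℝ, s ≤ t → (t : EReal) < b → flow φ D T s t x₀ ∈ U}

/-- The flow is order-preserving on `U`. -/
def IsOrderPreservingOn (C : ProperCone ℝ X) (φ : ℝ → X → X) (D : Set X) (T : EReal)
    (U : Set X) : Prop :=
  ∀ x₁ ∈ U, ∀ x₂ ∈ U, ConeLE C x₂ x₁ → ∀ s t : ℝ, 0 ≤ s → s ≤ t →
    (t : EReal) < min (exitTime φ D T U s x₁) (exitTime φ D T U s x₂) →
      ConeLE C (flow φ D T s t x₂) (flow φ D T s t x₁)

/-- The flow contracts Thompson's metric on `U` with rate `α ∈ ℝ`. -/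
def ContractsThompson (C : ProperCone ℝ X) (φ : ℝ → X → X) (D : Set X) (T : EReal)
    (U : Set X) (α : ℝ) : Prop :=
  ∀ x₁ ∈ U, ∀ x₂ ∈ U, ∀ s t : ℝ, 0 ≤ s → s ≤ t →
    (t : EReal) < min (exitTime φ D T U s x₁) (exitTime φ D T U s x₂) →
      thompsonDist C (flow φ D T s t x₁) (flow φ D T s t x₂) ≤
        Real.exp (-α * (t - s)) * thompsonDist C x₁ x₂

/-- `Dφ_s(x) x - φ(s,x) ≤ -α x` for all `s ∈ J` and `x ∈ U`. -/
def InfinitesimalContraction (C : ProperCone ℝ X) (φ : ℝ → X → X) (T : EReal)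
    (U : Set X) (α : ℝ) : Prop :=
  ∀ s ∈ timeInterval T, ∀ x ∈ U, ConeLE C (fderiv ℝ (φ s) x x - φ s x) (-(α • x))

/-- The regularity assumptions on `φ` on `J × D`, `J = [0,T)`: joint continuity, Fréchet
differentiability in the second variable, and a bound on the derivative, uniform in time, on each
closed bounded subset of `D`. -/
structure IsRegularField (φ : ℝ → X → X) (D : Set X) (T : EReal) : Prop where
  continuousOn : ContinuousOn (fun p : ℝ × X => φ p.1 p.2) (timeInterval T ×ˢ D)
  differentiableAt : ∀ t ∈ timeInterval T, ∀ x ∈ D, DifferentiableAt ℝ (φ t) x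
  bounded_fderiv : ∀ K : Set X, K ⊆ D → IsClosed K → Bornology.IsBounded K →
    ∃ L : ℝ, ∀ t ∈ timeInterval T, ∀ x ∈ K, ‖fderiv ℝ (φ t) x‖ ≤ L

end ConeFlow

end

/-!
Preservation of order makes every `φ_t` quasimonotone, and for quasimonotone fields a subsolution
lying initially below a supersolution stays below it: perturb the supersolution by a small, growing
multiple of an interior point of the cone to make it strict, and test the first contact with a
supporting functional.

Condition (b) says that the rescaled field `e⁻ʳ φ_t(eʳ x) + α r x` decreases with `r`. Hence, if `x`
is a trajectory and `ρ(t) = r e^{-α(t-s)}`, then `e^ρ x` is a supersolution. Since `d_T(x, y) ≤ r`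
means `x ≤ eʳ y` and `y ≤ eʳ x`, comparison with it yields (a). Conversely, (a) gives
`M_s^t(eʳ x) ≤ e^{ρ(t)} M_s^t(x)`, and differentiating at `t = s` shows that the rescaled field is
at most its value at `r = 0`, which is (b) to first order in `r`.

For a rapidly growing `ρ`, the curves `e^{-ρ(t)} x₀` and `e^{ρ(t)} x₀` are a sub- and a
supersolution, so on a bounded time interval the trajectory of `x₀` remains in an order interval
inside `C₀`. For a normal cone this interval is bounded, hence `φ` is bounded along the trajectory,
which therefore has a limit in `C₀` and can be continued.
-/

namespace ConeFlow

open Filter Metric Topology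

variable {X : Type*} [NormedAddCommGroup X] [NormedSpace ℝ X]

section ODE

variable {φ : ℝ → X → X} {D K : Set X} {T b b₁ b₂ : EReal} {s a t : ℝ} {x₀ : X} {x y : ℝ → X}

lemma eventually_coe_lt (h : (t : EReal) < b) : ∀ᶠ u : ℝ in 𝓝 t, (u : EReal) < b :=
  continuous_coe_real_ereal.continuousAt.eventually_lt_const h

lemma Icc_subset_timeInterval (hs : 0 ≤ s) (ht : (t : EReal) < T) : Icc s t ⊆ timeInterval T :=
  fun _ hu => ⟨hs.trans hu.1, (EReal.coe_le_coe_iff.2 hu.2).trans_lt ht⟩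

/-! ### Regular fields -/

namespace IsRegularField

lemma continuousOn_time (hφ : IsRegularField φ D T) {p : X} (hp : p ∈ D) :
    ContinuousOn (fun t => φ t p) (timeInterval T) :=
  hφ.continuousOn.comp (f := fun t => (t, p)) (by fun_prop) fun _ ht => ⟨ht, hp⟩

lemma exists_lipschitzOnWith (hφ : IsRegularField φ D T) (hKD : K ⊆ D) (hKc : IsClosed K)
    (hKb : Bornology.IsBounded K) (hK : Convex ℝ K) :
    ∃ L : NNReal, ∀ t ∈ timeInterval T, LipschitzOnWith L (φ t) K := by
  obtain ⟨L, hL⟩ := hφ.bounded_fderiv K hKD hKc hKb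
  refine ⟨L.toNNReal, fun t ht => hK.lipschitzOnWith_of_nnnorm_fderiv_le
    (fun x hx => hφ.differentiableAt t ht x (hKD hx)) fun x hx => ?_⟩
  exact NNReal.coe_le_coe.1 ((hL t ht x hx).trans (Real.le_coe_toNNReal L))

lemma exists_norm_le (hφ : IsRegularField φ D T) (hKD : K ⊆ D) (hKc : IsClosed K)
    (hKb : Bornology.IsBounded K) (hK : Convex ℝ K) (hJ : Icc s t ⊆ timeInterval T) :
    ∃ M : NNReal, ∀ u ∈ Icc s t, ∀ x ∈ K, ‖φ u x‖ ≤ M := by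
  obtain rfl | ⟨p, hp⟩ := K.eq_empty_or_nonempty
  · simp
  obtain ⟨L, hL⟩ := hφ.exists_lipschitzOnWith hKD hKc hKb hK
  obtain ⟨R, hR⟩ := isBounded_iff.1 hKb
  obtain ⟨M, hM⟩ := isCompact_Icc.exists_bound_of_continuousOn
    ((hφ.continuousOn_time (hKD hp)).mono hJ)
  refine ⟨(M + L * R).toNNReal, fun u hu x hx => le_trans ?_ (Real.le_coe_toNNReal _)⟩
  calc ‖φ u x‖ ≤ ‖φ u p‖ + ‖φ u x - φ u p‖ := norm_le_norm_add_norm_sub' _ _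
    _ ≤ M + L * dist x p := by
      rw [← dist_eq_norm]
      exact add_le_add (hM u hu) ((hL u (hJ hu)).dist_le_mul x hx p hp)
    _ ≤ M + L * R := by gcongr; exact hR hx hp

theorem exists_isSolution [CompleteSpace X] (hφ : IsRegularField φ D T) (hD : IsOpen D)
    (hs : s ∈ timeInterval T) (hx₀ : x₀ ∈ D) :
    ∃ b : ℝ, s < b ∧ (b : EReal) < T ∧ ∃ x, IsSolution φ D s x₀ b x := by
  obtain ⟨δ, hδ, hball⟩ := nhds_basis_closedBall.mem_iff.1 (hD.mem_nhds hx₀)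
  lift δ to NNReal using hδ.le
  obtain ⟨L, hL⟩ := hφ.exists_lipschitzOnWith hball isClosed_closedBall isBounded_closedBall
    (convex_closedBall x₀ δ)
  obtain ⟨c, hsc, hcT⟩ := EReal.lt_iff_exists_real_btwn.1 hs.2
  obtain ⟨M, hM⟩ := hφ.exists_norm_le hball isClosed_closedBall isBounded_closedBall
    (convex_closedBall x₀ δ) (Icc_subset_timeInterval hs.1 hcT)
  have hshort : ∀ᶠ d in 𝓝[>] s, M * (d - s) < δ :=
    nhdsWithin_le_nhds <| Continuous.tendsto (f := fun d : ℝ => M * (d - s)) (by fun_prop) s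
      |>.eventually_lt_const (by simpa using hδ)
  have hnear : ∀ᶠ d in 𝓝[>] s, d ∈ Ioo s c := Ioo_mem_nhdsGT (EReal.coe_lt_coe_iff.1 hsc)
  obtain ⟨d, ⟨hsd, hdc⟩, hMd⟩ := (hnear.and hshort).exists
  have hJ : Icc s d ⊆ timeInterval T :=
    (Icc_subset_Icc_right hdc.le).trans (Icc_subset_timeInterval hs.1 hcT)
  have hPL : IsPicardLindelof φ (⟨s, left_mem_Icc.2 hsd.le⟩ : Icc s d) x₀ δ 0 M L :=
    { lipschitzOnWith := fun t ht => hL t (hJ ht)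
      continuousOn := fun p hp => (hφ.continuousOn_time (hball hp)).mono hJ
      norm_le := fun t ht p hp => hM t ⟨ht.1, ht.2.trans hdc.le⟩ p hp
      mul_max_le := by simpa [hsd.le] using hMd.le }
  obtain ⟨x, hxs, hx⟩ := hPL.exists_eq_forall_mem_Icc_hasDerivWithinAt₀
  have hxc : ContinuousWithinAt x (Ici s) s :=
    (hx s (left_mem_Icc.2 hsd.le)).continuousWithinAt.mono_of_mem_nhdsWithin (Icc_mem_nhdsGE hsd)
  have hxD : ∀ᶠ t in 𝓝[≥] s, x t ∈ D := hxc.eventually_mem (hD.mem_nhds (by rwa [hxs]))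
  obtain ⟨b, hsb, hb⟩ := mem_nhdsGE_iff_exists_Ico_subset.1
    (hxD.and (Ico_mem_nhdsGE hsd))
  refine ⟨min b d, lt_min hsb hsd, ?_, x, hxs, fun t hst ht => ?_⟩
  · exact (EReal.coe_le_coe_iff.2 ((min_le_right _ _).trans hdc.le)).trans_lt hcT
  · obtain ⟨htb, htd⟩ := lt_min_iff.1 (EReal.coe_lt_coe_iff.1 ht)
    refine ⟨(hb ⟨hst, htb⟩).1, (hx t ⟨hst, htd.le⟩).mono_of_mem_nhdsWithin ?_⟩
    exact inter_mem self_mem_nhdsWithin (nhdsWithin_le_nhds (Iic_mem_nhds htd))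

end IsRegularField

/-! ### Solutions -/

namespace IsSolution

lemma tail (hx : IsSolution φ D s x₀ b x) (hst : s ≤ t) : IsSolution φ D t (x t) b x :=
  ⟨rfl, fun u htu hub => ⟨(hx.2 u (hst.trans htu) hub).1,
    (hx.2 u (hst.trans htu) hub).2.mono (Ici_subset_Ici.2 hst)⟩⟩

lemma congr (hx : IsSolution φ D s x₀ b x) (hsb : (s : EReal) < b)
    (hxy : ∀ t : ℝ, s ≤ t → (t : EReal) < b → y t = x t) : IsSolution φ D s x₀ b y := by
  refine ⟨(hxy s le_rfl hsb).trans hx.1, fun t hst htb => ?_⟩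
  rw [hxy t hst htb]
  refine ⟨(hx.2 t hst htb).1, (hx.2 t hst htb).2.congr_of_eventuallyEq ?_ (hxy t hst htb)⟩
  filter_upwards [nhdsWithin_le_nhds (eventually_coe_lt htb), self_mem_nhdsWithin]
    with u hub hsu using hxy u hsu hub

lemma continuousOn_Icc (hx : IsSolution φ D s x₀ b x) (htb : (t : EReal) < b) :
    ContinuousOn x (Icc s t) := fun u hu =>
  (hx.2 u hu.1 ((EReal.coe_le_coe_iff.2 hu.2).trans_lt htb)).2.continuousWithinAt.mono
    Icc_subset_Ici_self

lemma hasDerivAt (hx : IsSolution φ D s x₀ b x) (hst : s < t) (htb : (t : EReal) < b) :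
    HasDerivAt x (φ t (x t)) t :=
  (hx.2 t hst.le htb).2.hasDerivAt (Ici_mem_nhds hst)

lemma eventuallyEq (hφ : IsRegularField φ D T) (hD : IsOpen D) (hs : s ∈ timeInterval T)
    (hx : IsSolution φ D s x₀ b₁ x) (hy : IsSolution φ D s x₀ b₂ y) (hb₁ : (s : EReal) < b₁)
    (hb₂ : (s : EReal) < b₂) : x =ᶠ[𝓝[≥] s] y := by
  have hx₀ : x₀ ∈ D := hx.1 ▸ (hx.2 s le_rfl hb₁).1
  obtain ⟨δ, hδ, hball⟩ := nhds_basis_closedBall.mem_iff.1 (hD.mem_nhds hx₀)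
  obtain ⟨L, hL⟩ := hφ.exists_lipschitzOnWith hball isClosed_closedBall isBounded_closedBall
    (convex_closedBall x₀ δ)
  have near : ∀ {b : EReal} {z : ℝ → X}, IsSolution φ D s x₀ b z → (s : EReal) < b →
      ∀ᶠ t in 𝓝[≥] s, z t ∈ closedBall x₀ δ := fun hz hb =>
    (hz.2 s le_rfl hb).2.continuousWithinAt.eventually_mem
      (by rw [hz.1]; exact closedBall_mem_nhds _ hδ)
  have htime : ∀ᶠ t : ℝ in 𝓝[≥] s, (t : EReal) < min (min b₁ b₂) T :=
    nhdsWithin_le_nhds (eventually_coe_lt (lt_min (lt_min hb₁ hb₂) hs.2))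
  obtain ⟨c, hsc, hc⟩ := mem_nhdsGE_iff_exists_Icc_subset.1
    ((near hx hb₁).and ((near hy hb₂).and htime))
  simp only [lt_min_iff] at hc
  have hcc := hc (right_mem_Icc.2 hsc.le)
  have hIco {t : ℝ} (ht : t ∈ Ico s c) := hc (Ico_subset_Icc_self ht)
  filter_upwards [Icc_mem_nhdsGE hsc] with t ht
  exact ODE_solution_unique_of_mem_Icc_right (v := φ) (s := fun _ => closedBall x₀ δ)
    (fun t ht => hL t ⟨hs.1.trans ht.1, (hIco ht).2.2.2⟩)
    (hx.continuousOn_Icc hcc.2.2.1.1)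
    (fun t ht => ((hx.tail ht.1).2 t le_rfl (hIco ht).2.2.1.1).2) (fun t ht => (hIco ht).1)
    (hy.continuousOn_Icc hcc.2.2.1.2)
    (fun t ht => ((hy.tail ht.1).2 t le_rfl (hIco ht).2.2.1.2).2) (fun t ht => (hIco ht).2.1)
    (hx.1.trans hy.1.symm) ht

theorem eqOn_Icc (hφ : IsRegularField φ D T) (hD : IsOpen D) (hs : 0 ≤ s)
    (hx : IsSolution φ D s x₀ b₁ x) (hy : IsSolution φ D s x₀ b₂ y) (ht₁ : (t : EReal) < b₁)
    (ht₂ : (t : EReal) < b₂) (htT : (t : EReal) < T) : EqOn x y (Icc s t) := by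
  have hclosed : IsClosed ({u | x u = y u} ∩ Icc s t) := by
    rw [inter_comm]
    exact ((hx.continuousOn_Icc ht₁).prodMk (hy.continuousOn_Icc ht₂)).preimage_isClosed_of_isClosed
      isClosed_Icc isClosed_diagonal
  refine hclosed.Icc_subset_of_forall_mem_nhdsWithin (hx.1.trans hy.1.symm) fun u ⟨hxy, hu⟩ => ?_
  have hut : (u : EReal) < t := EReal.coe_lt_coe_iff.2 hu.2
  have hy' : IsSolution φ D u (x u) b₂ y := by
    rw [show x u = y u from hxy]
    exact hy.tail hu.1
  exact nhdsWithin_mono u Ioi_subset_Ici_self ((hx.tail hu.1).eventuallyEq hφ hD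
    ⟨hs.trans hu.1, hut.trans htT⟩ hy' (hut.trans ht₁) (hut.trans ht₂))

lemma hasDerivWithinAt_Iic (hφ : IsRegularField φ D T) (hx : IsSolution φ D s x₀ a x)
    (hsa : s < a) (ha : a ∈ timeInterval T) (hs : 0 ≤ s) (hxa : x a ∈ D)
    (hlim : ContinuousWithinAt x (Iio a) a) : HasDerivWithinAt x (φ a (x a)) (Iic a) a := by
  have hderiv : ∀ t ∈ Ioo s a, HasDerivAt x (φ t (x t)) t := fun t ht =>
    hx.hasDerivAt ht.1 (EReal.coe_lt_coe_iff.2 ht.2)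
  refine hasDerivWithinAt_Iic_of_tendsto_deriv (s := Ioo s a)
    (fun t ht => (hderiv t ht).differentiableAt.differentiableWithinAt)
    (hlim.mono Ioo_subset_Iio_self) (Ioo_mem_nhdsLT hsa) ?_
  have hpair : Tendsto (fun t => (t, x t)) (𝓝[<] a) (𝓝[timeInterval T ×ˢ D] (a, x a)) := by
    refine tendsto_nhdsWithin_iff.2 ⟨(tendsto_id'.2 nhdsWithin_le_nhds).prodMk_nhds hlim, ?_⟩
    filter_upwards [Ioo_mem_nhdsLT hsa] with t ht
    exact ⟨Icc_subset_timeInterval hs ha.2 (Ioo_subset_Icc_self ht),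
      (hx.2 t ht.1.le (EReal.coe_lt_coe_iff.2 ht.2)).1⟩
  refine (Tendsto.comp (hφ.continuousOn (a, x a) ⟨ha, hxa⟩) hpair).congr' ?_
  filter_upwards [Ioo_mem_nhdsLT hsa] with t ht using (hderiv t ht).deriv.symm

lemma trans (hφ : IsRegularField φ D T) (h₁ : IsSolution φ D s x₀ a x)
    (h₂ : IsSolution φ D a (x a) b x) (hs : 0 ≤ s) (hsa : s < a) (haT : (a : EReal) < T)
    (hlim : ContinuousWithinAt x (Iio a) a) : IsSolution φ D s x₀ b x := by
  refine ⟨h₁.1, fun t hst htb => ?_⟩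
  obtain hta | rfl | hat := lt_trichotomy t a
  · exact h₁.2 t hst (EReal.coe_lt_coe_iff.2 hta)
  · obtain ⟨hmem, hright⟩ := h₂.2 t le_rfl htb
    have hleft := h₁.hasDerivWithinAt_Iic hφ hsa ⟨hs.trans hst, haT⟩ hs hmem hlim
    have hboth := hleft.union hright
    rw [Iic_union_Ici, hasDerivWithinAt_univ] at hboth
    exact ⟨hmem, hboth.hasDerivWithinAt⟩
  · exact ⟨(h₂.2 t hat.le htb).1, (h₂.hasDerivAt hat htb).hasDerivWithinAt⟩

end IsSolution

/-! ### Maximal solutions -/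

lemma maxTime_le : maxTime φ D T s x₀ ≤ T := sSup_le fun _ hb => hb.2.1

lemma exitTime_le (U : Set X) : exitTime φ D T U s x₀ ≤ T :=
  sSup_le fun _ hb => hb.2.1.le.trans maxTime_le

lemma IsSolution.le_maxTime (hx : IsSolution φ D s x₀ b x) (hsb : (s : EReal) < b) (hb : b ≤ T) :
    b ≤ maxTime φ D T s x₀ :=
  le_sSup ⟨hsb, hb, x, hx⟩

lemma flow_self : flow φ D T s s x₀ = x₀ := by
  unfold flow
  split_ifs with h
  · exact h.choose_spec.choose_spec.2.2.1
  · rfl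

lemma IsSolution.flow_eq (hφ : IsRegularField φ D T) (hD : IsOpen D) (hs : 0 ≤ s)
    (hx : IsSolution φ D s x₀ b x) (hb : b ≤ T) (hst : s ≤ t) (htb : (t : EReal) < b) :
    flow φ D T s t x₀ = x t := by
  have h : ∃ y : ℝ → X, ∃ c : EReal, (t : EReal) < c ∧ c ≤ T ∧ IsSolution φ D s x₀ c y :=
    ⟨x, b, htb, hb, hx⟩
  obtain ⟨c, htc, -, hy⟩ := h.choose_spec
  rw [flow, dif_pos h]
  exact hy.eqOn_Icc hφ hD hs hx htc htb (htb.trans_le hb) (right_mem_Icc.2 hst)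

theorem isSolution_flow (hφ : IsRegularField φ D T) (hD : IsOpen D) (hs : 0 ≤ s) :
    IsSolution φ D s x₀ (maxTime φ D T s x₀) (fun t => flow φ D T s t x₀) := by
  refine ⟨flow_self, fun t hst ht => ?_⟩
  obtain ⟨b, ⟨hsb, hbT, x, hx⟩, htb⟩ := lt_sSup_iff.1 ht
  exact (hx.congr hsb fun u hsu hub => hx.flow_eq hφ hD hs hbT hsu hub).2 t hst htb

section Complete

variable [CompleteSpace X]

lemma lt_maxTime (hφ : IsRegularField φ D T) (hD : IsOpen D) (hs : s ∈ timeInterval T)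
    (hx₀ : x₀ ∈ D) : (s : EReal) < maxTime φ D T s x₀ := by
  obtain ⟨b, hsb, hbT, x, hx⟩ := hφ.exists_isSolution hD hs hx₀
  have hsb' := EReal.coe_lt_coe_iff.2 hsb
  exact hsb'.trans_le (hx.le_maxTime hsb' hbT.le)

lemma exitTime_eq_maxTime (hφ : IsRegularField φ D T) (hD : IsOpen D) (hs : s ∈ timeInterval T)
    (hx₀ : x₀ ∈ D) : exitTime φ D T D s x₀ = maxTime φ D T s x₀ := by
  refine le_antisymm (sSup_le fun b hb => hb.2.1.le) (le_of_forall_lt fun c hc => ?_)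
  obtain ⟨b, hb, hbm⟩ := exists_between (max_lt hc (lt_maxTime hφ hD hs hx₀))
  obtain ⟨hcb, hsb⟩ := max_lt_iff.1 hb
  exact hcb.trans_le (le_sSup ⟨hsb, hbm, fun t hst htb =>
    ((isSolution_flow hφ hD hs.1).2 t hst (htb.trans hbm)).1⟩)

lemma hasDerivWithinAt_flow_self (hφ : IsRegularField φ D T) (hD : IsOpen D)
    (hs : s ∈ timeInterval T) (hx₀ : x₀ ∈ D) :
    HasDerivWithinAt (fun t => flow φ D T s t x₀) (φ s x₀) (Ici s) s := by
  simpa only [flow_self] using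
    ((isSolution_flow hφ hD hs.1).2 s le_rfl (lt_maxTime hφ hD hs hx₀)).2

theorem IsSolution.lt_maxTime_of_tendsto (hφ : IsRegularField φ D T) (hD : IsOpen D) (hs : 0 ≤ s)
    (hx : IsSolution φ D s x₀ a x) (hsa : s < a) (haT : (a : EReal) < T) {p : X} (hp : p ∈ D)
    (hlim : Tendsto x (𝓝[<] a) (𝓝 p)) : (a : EReal) < maxTime φ D T s x₀ := by
  obtain ⟨b, hab, hbT, y, hy⟩ := hφ.exists_isSolution hD ⟨hs.trans hsa.le, haT⟩ hp
  have hab' := EReal.coe_lt_coe_iff.2 hab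
  have hsa' := EReal.coe_lt_coe_iff.2 hsa
  set z : ℝ → X := fun t => if t < a then x t else y t
  have hzx : IsSolution φ D s x₀ a z :=
    hx.congr hsa' fun t _ hta => if_pos (EReal.coe_lt_coe_iff.1 hta)
  have hzy : IsSolution φ D a p b z := hy.congr hab' fun t hat _ => if_neg hat.not_gt
  have hzlim : ContinuousWithinAt z (Iio a) a := by
    rw [ContinuousWithinAt, hzy.1]
    exact hlim.congr' (eventually_nhdsWithin_of_forall fun t hta => (if_pos hta).symm)
  have hz : IsSolution φ D s x₀ b z :=
    hzx.trans hφ (hzy.1.symm ▸ hzy) hs hsa haT hzlim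
  exact hab'.trans_le (hz.le_maxTime (hsa'.trans hab') hbT.le)

theorem IsSolution.lt_maxTime_of_forall_mem (hφ : IsRegularField φ D T) (hD : IsOpen D)
    (hs : 0 ≤ s) (hx : IsSolution φ D s x₀ a x) (hsa : s < a) (haT : (a : EReal) < T)
    (hKD : K ⊆ D) (hKc : IsClosed K) (hKb : Bornology.IsBounded K) (hK : Convex ℝ K)
    (hxK : ∀ t ∈ Ico s a, x t ∈ K) : (a : EReal) < maxTime φ D T s x₀ := by
  obtain ⟨M, hM⟩ := hφ.exists_norm_le hKD hKc hKb hK (Icc_subset_timeInterval hs haT)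
  have hlip : LipschitzOnWith M x (Ico s a) :=
    (convex_Ico s a).lipschitzOnWith_of_nnnorm_hasDerivWithin_le (f' := fun t => φ t (x t))
      (fun t ht => (hx.2 t ht.1 (EReal.coe_lt_coe_iff.2 ht.2)).2.mono Ico_subset_Ici_self)
      fun t ht => NNReal.coe_le_coe.1 (hM t (Ico_subset_Icc_self ht) _ (hxK t ht))
  have hcauchy : Cauchy (map x (𝓝[<] a)) := (cauchy_nhds.mono nhdsWithin_le_nhds).map_of_le
    hlip.uniformContinuousOn (le_principal_iff.2 (Ico_mem_nhdsLT hsa))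
  obtain ⟨p, hp⟩ := CompleteSpace.complete hcauchy
  have hpK : p ∈ K := hKc.mem_of_tendsto hp (mem_of_superset (Ico_mem_nhdsLT hsa) hxK)
  exact hx.lt_maxTime_of_tendsto hφ hD hs hsa haT (hKD hpK) hp

end Complete

end ODE

/-! ### The order of a cone with interior -/

section Cone

variable {C : ProperCone ℝ X} {x y z e p : X} {r r' s t : ℝ}

lemma ConeLE.trans (hxy : ConeLE C x y) (hyz : ConeLE C y z) : ConeLE C x z := by
  simpa [ConeLE] using C.add_mem hyz hxy

lemma ConeLE.smul (h : ConeLE C x y) (hr : 0 ≤ r) : ConeLE C (r • x) (r • y) := by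
  simpa [ConeLE, smul_sub] using C.smul_mem h hr

lemma smul_coneLE_smul (hx : x ∈ C) (h : r ≤ r') : ConeLE C (r • x) (r' • x) := by
  simpa [ConeLE, sub_smul] using C.smul_mem hx (sub_nonneg.2 h)

lemma coneLE_neg_iff : ConeLE C x (-y) ↔ -(x + y) ∈ C := by rw [ConeLE, neg_add_rev, sub_eq_add_neg]

lemma isOpen_coneInterior : IsOpen (coneInterior C) := isOpen_interior

lemma mem_of_mem_coneInterior (hx : x ∈ coneInterior C) : x ∈ C := interior_subset hx

lemma add_mem_coneInterior (hx : x ∈ coneInterior C) (hy : y ∈ C) : x + y ∈ coneInterior C := by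
  refine mem_interior.2 ⟨(· - y) ⁻¹' coneInterior C, fun v hv => ?_,
    isOpen_coneInterior.preimage (by fun_prop), by simpa using hx⟩
  simpa using C.add_mem (mem_of_mem_coneInterior hv) hy

lemma ConeLE.mem_coneInterior (h : ConeLE C x y) (hx : x ∈ coneInterior C) :
    y ∈ coneInterior C := by
  simpa using add_mem_coneInterior hx h

lemma smul_mem_coneInterior (hx : x ∈ coneInterior C) (hr : 0 < r) : r • x ∈ coneInterior C := by
  refine mem_interior.2 ⟨(r⁻¹ • ·) ⁻¹' coneInterior C, fun v hv => ?_,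
    isOpen_coneInterior.preimage (by fun_prop), by simpa [smul_smul, hr.ne'] using hx⟩
  simpa [smul_smul, hr.ne'] using C.smul_mem (mem_of_mem_coneInterior hv) hr.le

theorem exists_forall_coneLE_smul (he : e ∈ coneInterior C) :
    ∃ κ : ℝ, 0 < κ ∧ ∀ v : X, ConeLE C v ((κ * ‖v‖) • e) := by
  obtain ⟨δ, hδ, hball⟩ := nhds_basis_closedBall.mem_iff.1 (mem_interior_iff_mem_nhds.1 he)
  refine ⟨δ⁻¹, inv_pos.2 hδ, fun v => ?_⟩
  obtain rfl | hv := eq_or_ne v 0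
  · simp [ConeLE]
  have hmem : e - (δ / ‖v‖) • v ∈ C := hball <| by
    simp [norm_smul, abs_of_pos hδ, hv]
  have hscale : δ⁻¹ * ‖v‖ * (δ / ‖v‖) = 1 := by field_simp [norm_ne_zero_iff.2 hv]
  simpa [ConeLE, smul_sub, smul_smul, hscale] using
    C.smul_mem hmem (show 0 ≤ δ⁻¹ * ‖v‖ by positivity)

lemma zero_notMem_coneInterior (hC : C ≠ ⊤) : (0 : X) ∉ coneInterior C := by
  refine fun h => hC (eq_top_iff.2 fun v _ => ?_)
  obtain ⟨κ, -, hκ⟩ := exists_forall_coneLE_smul h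
  simpa [ConeLE] using hκ (-v)

lemma neg_notMem_of_mem_coneInterior (hC : C ≠ ⊤) (hx : x ∈ coneInterior C) : -x ∉ C := fun h =>
  zero_notMem_coneInterior hC (by simpa using add_mem_coneInterior hx h)

theorem mem_of_forall_dual_nonneg
    (h : ∀ ψ : StrongDual ℝ X, (∀ y ∈ C, 0 ≤ ψ y) → 0 ≤ ψ x) : x ∈ C := by
  by_contra hx
  obtain ⟨ψ, hψ, hneg⟩ := C.hyperplane_separation_point hx
  exact (h ψ hψ).not_gt hneg

/-- `ψ` supports the cone `C` at `p`: it is nonnegative on `C`, positive on the interior of `C`,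
and vanishes at `p`. -/
structure IsSupportingFunctional (C : ProperCone ℝ X) (p : X) (ψ : StrongDual ℝ X) : Prop where
  nonneg : ∀ x ∈ C, 0 ≤ ψ x
  pos : ∀ x ∈ coneInterior C, 0 < ψ x
  map_eq_zero : ψ p = 0

theorem exists_isSupportingFunctional (he : e ∈ coneInterior C) (hp : p ∈ C)
    (hp' : p ∉ coneInterior C) : ∃ ψ, IsSupportingFunctional C p ψ := by
  obtain ⟨f, hf⟩ := geometric_hahn_banach_open_point C.convex.interior isOpen_interior hp'
  have hle : ∀ x ∈ C, f x ≤ f p := by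
    have hsub : closure (interior (C : Set X)) ⊆ {x | f x ≤ f p} :=
      closure_minimal (fun x hx => (hf x hx).le) (isClosed_le f.continuous continuous_const)
    rw [C.convex.closure_interior_eq_closure_of_nonempty_interior ⟨e, he⟩] at hsub
    exact fun x hx => hsub (subset_closure hx)
  have hp0 : f p = 0 := by
    have h0 := hle 0 C.zero_mem
    have h2 := hle ((2 : ℝ) • p) (C.smul_mem hp zero_le_two)
    simp only [map_zero, map_smul, smul_eq_mul] at h0 h2
    linarith
  exact ⟨-f, fun x hx => by simpa [hp0] using hle x hx, fun x hx => by simpa [hp0] using hf x hx,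
    by simp [hp0]⟩

theorem mem_of_hasDerivWithinAt {g : ℝ → X} {g' : X} (hg : HasDerivWithinAt g g' (Ici s) s)
    (hgs : g s = 0) (hmem : ∀ᶠ t in 𝓝[>] s, g t ∈ C) : g' ∈ C := by
  refine C.isClosed.mem_of_tendsto
    ((hasDerivWithinAt_iff_tendsto_slope' self_notMem_Ioi).1 hg.Ioi_of_Ici) ?_
  filter_upwards [hmem, self_mem_nhdsWithin] with t ht hst
  rw [slope_def_module, hgs, sub_zero]
  exact C.smul_mem ht (inv_nonneg.2 (sub_nonneg.2 (le_of_lt hst)))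

theorem coneLE_of_hasDerivAt {g g' : ℝ → X} (hst : s ≤ t)
    (hg : ∀ u ∈ Icc s t, HasDerivAt g (g' u) u) (hg' : ∀ u ∈ Icc s t, g' u ∈ C) :
    ConeLE C (g s) (g t) := by
  refine mem_of_forall_dual_nonneg fun ψ hψ => ?_
  have hd : ∀ u ∈ Icc s t, HasDerivAt (ψ ∘ g) (ψ (g' u)) u := fun u hu =>
    ψ.hasFDerivAt.comp_hasDerivAt u (hg u hu)
  have hmono : MonotoneOn (ψ ∘ g) (Icc s t) :=
    monotoneOn_of_hasDerivWithinAt_nonneg (convex_Icc s t)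
      (fun u hu => (hd u hu).continuousAt.continuousWithinAt)
      (fun u hu => (hd u (interior_subset hu)).hasDerivWithinAt)
      fun u hu => hψ _ (hg' u (interior_subset hu))
  simpa using hmono (left_mem_Icc.2 hst) (right_mem_Icc.2 hst) hst

/-! ### Thompson's metric -/

lemma pos_of_coneLE_smul (hC : C ≠ ⊤) (hx : x ∈ coneInterior C) (hy : y ∈ C)
    (h : ConeLE C x (t • y)) : 0 < t := by
  by_contra! ht
  refine neg_notMem_of_mem_coneInterior hC hx ?_
  simpa [ConeLE] using h.trans (smul_coneLE_smul hy ht)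

lemma one_le_of_coneLE_smul (hC : C ≠ ⊤) (hx : x ∈ coneInterior C) (h : ConeLE C x (t • x)) :
    1 ≤ t := by
  by_contra! ht
  refine neg_notMem_of_mem_coneInterior hC (smul_mem_coneInterior hx (sub_pos.2 ht)) ?_
  simpa [ConeLE, sub_smul] using h

lemma gaugeM_le_iff (hC : C ≠ ⊤) (hx : x ∈ coneInterior C) (hy : y ∈ coneInterior C) :
    gaugeM C x y ≤ t ↔ ConeLE C x (t • y) := by
  have hyC := mem_of_mem_coneInterior hy
  have hbdd : BddBelow {t : ℝ | ConeLE C x (t • y)} :=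
    ⟨0, fun u hu => (pos_of_coneLE_smul hC hx hyC hu).le⟩
  have hclosed : IsClosed {t : ℝ | ConeLE C x (t • y)} :=
    C.isClosed.preimage (f := fun t : ℝ => t • y - x) (by fun_prop)
  obtain ⟨κ, -, hκ⟩ := exists_forall_coneLE_smul hy
  have hgauge : ConeLE C x (gaugeM C x y • y) := hclosed.csInf_mem ⟨_, hκ x⟩ hbdd
  exact ⟨fun h => hgauge.trans (smul_coneLE_smul hyC h), fun h => csInf_le hbdd h⟩

lemma thompsonDist_le_iff (hC : C ≠ ⊤) (hx : x ∈ coneInterior C) (hy : y ∈ coneInterior C) :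
    thompsonDist C x y ≤ r ↔ ConeLE C x (Real.exp r • y) ∧ ConeLE C y (Real.exp r • x) := by
  have hpos : 0 < gaugeM C x y := pos_of_coneLE_smul hC hx (mem_of_mem_coneInterior hy)
    ((gaugeM_le_iff hC hx hy).1 le_rfl)
  rw [thompsonDist, Real.log_le_iff_le_exp (lt_max_of_lt_left hpos), max_le_iff,
    gaugeM_le_iff hC hx hy, gaugeM_le_iff hC hy hx]

lemma thompsonDist_nonneg (hC : C ≠ ⊤) (hx : x ∈ coneInterior C) (hy : y ∈ coneInterior C) :
    0 ≤ thompsonDist C x y := by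
  obtain ⟨hxy, hyx⟩ := (thompsonDist_le_iff hC hx hy).1 le_rfl
  have h := one_le_of_coneLE_smul hC hx <| by
    simpa only [smul_smul, ← Real.exp_add] using hxy.trans (hyx.smul (Real.exp_pos _).le)
  linarith [Real.one_le_exp_iff.1 h]

lemma thompsonDist_exp_smul_self_le (hC : C ≠ ⊤) (hx : x ∈ coneInterior C) (hr : 0 ≤ r) :
    thompsonDist C (Real.exp r • x) x ≤ r := by
  refine (thompsonDist_le_iff hC (smul_mem_coneInterior hx (Real.exp_pos r)) hx).2
    ⟨by simp [ConeLE], ?_⟩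
  have h : 1 ≤ Real.exp (r + r) := Real.one_le_exp (by positivity)
  simpa [smul_smul, ← Real.exp_add] using smul_coneLE_smul (mem_of_mem_coneInterior hx) h

-- For `C = ⊤` every gauge is the junk infimum `sInf univ = 0`, and `log 0 = 0`.
lemma thompsonDist_top : thompsonDist (⊤ : ProperCone ℝ X) x y = 0 := by
  simp [thompsonDist, gaugeM, ConeLE]

end Cone

/-! ### Radial monotonicity -/

/-- The vector field `x ↦ e⁻ʳ φ(t, eʳ x) + α r x`, obtained from `φ` by rescaling along the ray
through `x`. Its `r`-derivative at `0` is `Dφ_t(x) x - φ(t, x) + α x`, so that condition (b) of the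
contraction theorem says that it decreases with `r`. -/
noncomputable def radialField (φ : ℝ → X → X) (α t : ℝ) (x : X) (r : ℝ) : X :=
  Real.exp (-r) • φ t (Real.exp r • x) + (α * r) • x

section Radial

variable {C : ProperCone ℝ X} {φ : ℝ → X → X} {T : EReal} {α r ρ ρ' ε t : ℝ} {x v : X}

lemma radialField_zero : radialField φ α t x 0 = φ t x := by simp [radialField]

lemma hasDerivAt_radialField (h : DifferentiableAt ℝ (φ t) (Real.exp r • x)) :
    HasDerivAt (radialField φ α t x)
      (Real.exp (-r) • (fderiv ℝ (φ t) (Real.exp r • x) (Real.exp r • x) - φ t (Real.exp r • x)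
        + α • Real.exp r • x)) r := by
  have hfield := h.hasFDerivAt.comp_hasDerivAt r ((Real.hasDerivAt_exp r).smul_const x)
  have hlinear : HasDerivAt (fun r => (α * r) • x) (α • x) r := by
    simpa using ((hasDerivAt_id r).const_mul α).smul_const x
  refine (((hasDerivAt_neg r).exp.smul hfield).add hlinear).congr_deriv ?_
  have hexp : Real.exp (-r) * Real.exp r = 1 := by rw [← Real.exp_add]; simp
  have hx : Real.exp (-r) • α • Real.exp r • x = α • x := by
    rw [smul_comm α, smul_smul, hexp, one_smul]
  rw [smul_add, hx, Function.comp_apply]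
  module

theorem InfinitesimalContraction.radialField_coneLE
    (h : InfinitesimalContraction C φ T (coneInterior C) α)
    (hφ : IsRegularField φ (coneInterior C) T) (ht : t ∈ timeInterval T)
    (hx : x ∈ coneInterior C) (hr : 0 ≤ r) : ConeLE C (radialField φ α t x r) (φ t x) := by
  have hmem (u : ℝ) : Real.exp u • x ∈ coneInterior C := smul_mem_coneInterior hx (Real.exp_pos u)
  have hanti : ConeLE C (-radialField φ α t x 0) (-radialField φ α t x r) :=
    coneLE_of_hasDerivAt hr
      (fun u _ => (hasDerivAt_radialField (hφ.differentiableAt t ht _ (hmem u))).neg) fun u _ => by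
        rw [← smul_neg]
        refine C.smul_mem ?_ (Real.exp_pos _).le
        exact coneLE_neg_iff.1 (h t ht _ (hmem u))
  simpa [ConeLE, radialField_zero, neg_add_eq_sub] using hanti

theorem infinitesimalContraction_of_radialField_coneLE (hφ : IsRegularField φ (coneInterior C) T)
    (h : ∀ t ∈ timeInterval T, ∀ x ∈ coneInterior C, ∀ r > 0,
      ConeLE C (radialField φ α t x r) (φ t x)) :
    InfinitesimalContraction C φ T (coneInterior C) α := by
  intro t ht x hx
  have hd := (hasDerivAt_radialField (φ := φ) (α := α) (r := 0)
    (hφ.differentiableAt t ht _ (by simpa using hx))).const_sub (φ t x)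
  have hmem := mem_of_hasDerivWithinAt hd.hasDerivWithinAt (by simp [radialField_zero])
    (eventually_nhdsWithin_of_forall fun r hr => h t ht x hx r hr)
  exact coneLE_neg_iff.2 (by simpa using hmem)

-- If a curve has velocity `v` at `x`, its multiple by `e^{ρ(t)}` (below: by `e^{-ρ(t)}`) has the
-- velocity displayed in the conclusion, so these are criteria for super- and subsolutions.
lemma coneLE_of_radialField_coneLE (h : ConeLE C (radialField φ α t x ρ) (φ t x)) (hx : x ∈ C)
    (hε : ε ≤ ρ' + α * ρ) (hv : ConeLE C (φ t x) (v + ε • x)) :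
    ConeLE C (φ t (Real.exp ρ • x)) (Real.exp ρ • v + (Real.exp ρ * ρ') • x) := by
  have hsum := C.smul_mem (C.add_mem (h.trans hv) (smul_coneLE_smul hx hε)) (Real.exp_pos ρ).le
  rw [radialField, Real.exp_neg] at hsum
  rw [ConeLE]
  convert hsum using 1
  match_scalars <;> field_simp
  ring

lemma coneLE_of_radialField_neg_coneLE
    (h : ConeLE C (radialField φ α t (Real.exp (-ρ) • x) ρ) (φ t (Real.exp (-ρ) • x)))
    (hx : x ∈ C) (hε : ε ≤ ρ' + α * ρ) (hv : ConeLE C v (φ t x + ε • x)) :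
    ConeLE C (Real.exp (-ρ) • v + (Real.exp (-ρ) * -ρ') • x) (φ t (Real.exp (-ρ) • x)) := by
  have hsum : _ + _ ∈ C := C.add_mem h <| C.smul_mem (C.add_mem hv (smul_coneLE_smul hx hε))
    (Real.exp_pos (-ρ)).le
  have hexp : Real.exp ρ • Real.exp (-ρ) • x = x := by
    rw [smul_smul, ← Real.exp_add, add_neg_cancel, Real.exp_zero, one_smul]
  rw [radialField, hexp] at hsum
  rw [ConeLE]
  convert hsum using 1
  module

end Radial

/-! ### Comparison of sub- and supersolutions -/

section Comparison

variable {C : ProperCone ℝ X} {φ : ℝ → X → X} {D U : Set X} {T c : EReal} {s b τ : ℝ} {e x₀ : X}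
  {x y z : ℝ → X}

/-- Quasimonotonicity of a vector field with respect to `C`: whenever `y ≤ z` and a positive
functional does not distinguish `y` from `z`, it orders `f y` and `f z`. -/
def IsQuasimonotoneOn (C : ProperCone ℝ X) (f : X → X) (U : Set X) : Prop :=
  ∀ y ∈ U, ∀ z ∈ U, ConeLE C y z → ∀ ψ : StrongDual ℝ X, (∀ v ∈ C, 0 ≤ ψ v) → ψ y = ψ z →
    ψ (f y) ≤ ψ (f z)

/-- `y` is a subsolution of `ẋ = φ(t, x)` in `U` on `[s, b]`: its velocity is at most `φ(t, y)`. -/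
def IsSubsolutionOn (C : ProperCone ℝ X) (φ : ℝ → X → X) (U : Set X) (s b : ℝ) (y : ℝ → X) :
    Prop :=
  ∀ t ∈ Icc s b, y t ∈ U ∧ ∃ v, HasDerivWithinAt y v (Ici s) t ∧ ConeLE C v (φ t (y t))

/-- `z` is a supersolution of `ẋ = φ(t, x)` in `U` on `[s, b]`: its velocity is at least
`φ(t, z)`. -/
def IsSupersolutionOn (C : ProperCone ℝ X) (φ : ℝ → X → X) (U : Set X) (s b : ℝ) (z : ℝ → X) :
    Prop :=
  ∀ t ∈ Icc s b, z t ∈ U ∧ ∃ v, HasDerivWithinAt z v (Ici s) t ∧ ConeLE C (φ t (z t)) v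

/-- A supersolution whose velocity exceeds `φ(t, z)` by an interior element of the cone. -/
def IsStrictSupersolutionOn (C : ProperCone ℝ X) (φ : ℝ → X → X) (U : Set X) (s b : ℝ)
    (z : ℝ → X) : Prop :=
  ∀ t ∈ Icc s b, z t ∈ U ∧ ∃ v, HasDerivWithinAt z v (Ici s) t ∧ v - φ t (z t) ∈ coneInterior C

lemma IsSolution.isSubsolutionOn (hx : IsSolution φ U s x₀ c x) (hb : (b : EReal) < c) :
    IsSubsolutionOn C φ U s b x := fun t ht =>
  have h := hx.2 t ht.1 ((EReal.coe_le_coe_iff.2 ht.2).trans_lt hb)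
  ⟨h.1, _, h.2, by simp [ConeLE]⟩

lemma IsSolution.isSupersolutionOn (hx : IsSolution φ U s x₀ c x) (hb : (b : EReal) < c) :
    IsSupersolutionOn C φ U s b x := fun t ht =>
  have h := hx.2 t ht.1 ((EReal.coe_le_coe_iff.2 ht.2).trans_lt hb)
  ⟨h.1, _, h.2, by simp [ConeLE]⟩

lemma IsSupersolutionOn.continuousOn (hz : IsSupersolutionOn C φ U s b z) :
    ContinuousOn z (Icc s b) := fun t ht =>
  have ⟨_, _, hzv, _⟩ := hz t ht
  hzv.continuousWithinAt.mono Icc_subset_Ici_self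

lemma eventually_lt_min_exitTime [CompleteSpace X] (hφ : IsRegularField φ D T) (hD : IsOpen D)
    (hs : s ∈ timeInterval T) {x₁ x₂ : X} (hx₁ : x₁ ∈ D) (hx₂ : x₂ ∈ D) :
    ∀ᶠ t : ℝ in 𝓝[>] s, s < t ∧
      (t : EReal) < min (exitTime φ D T D s x₁) (exitTime φ D T D s x₂) := by
  rw [exitTime_eq_maxTime hφ hD hs hx₁, exitTime_eq_maxTime hφ hD hs hx₂]
  exact eventually_mem_nhdsWithin.and (nhdsWithin_le_nhds
    (eventually_coe_lt (lt_min (lt_maxTime hφ hD hs hx₁) (lt_maxTime hφ hD hs hx₂))))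

-- If `ψ y = ψ z`, then `ψ` of the difference of the two trajectories vanishes initially and stays
-- nonnegative, so its initial velocity `ψ (φ(τ, z) - φ(τ, y))` is nonnegative.
theorem IsOrderPreservingOn.isQuasimonotoneOn [CompleteSpace X]
    (hmono : IsOrderPreservingOn C φ D T D) (hφ : IsRegularField φ D T) (hD : IsOpen D)
    (hτ : τ ∈ timeInterval T) : IsQuasimonotoneOn C (φ τ) D := by
  intro y hy z hz hyz ψ hψ hψyz
  have hψ' := ψ.hasFDerivAt.comp_hasDerivWithinAt τ
    ((hasDerivWithinAt_flow_self hφ hD hτ hz).sub (hasDerivWithinAt_flow_self hφ hD hτ hy))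
  have hmem := mem_of_hasDerivWithinAt (C := ProperCone.positive ℝ ℝ) hψ'
    (by simp [flow_self, hψyz]) <| by
      filter_upwards [eventually_lt_min_exitTime hφ hD hτ hz hy] with t ht
      exact hψ _ (hmono z hz y hy hyz τ t hτ.1 ht.1.le ht.2)
  simpa using hmem

-- At the first time `p` leaves the interior, a supporting functional `ψ` at the exit point has
-- `ψ ∘ p` positive before and zero then, so `ψ ∘ p` cannot have positive derivative there.
theorem mem_coneInterior_of_forall_isSupportingFunctional {p : ℝ → X} (hsb : s ≤ b)
    (hps : p s ∈ coneInterior C)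
    (hp : ∀ t ∈ Icc s b, ∃ v, HasDerivWithinAt p v (Ici s) t ∧
      (p t ∈ C → ∀ ψ, IsSupportingFunctional C (p t) ψ → 0 < ψ v)) :
    p b ∈ coneInterior C := by
  by_contra hpb
  have hpc : ContinuousOn p (Icc s b) := fun t ht =>
    have ⟨_, hpv, _⟩ := hp t ht
    hpv.continuousWithinAt.mono Icc_subset_Ici_self
  have hclosed : IsClosed (Icc s b ∩ p ⁻¹' (coneInterior C)ᶜ) :=
    hpc.preimage_isClosed_of_isClosed isClosed_Icc isOpen_coneInterior.isClosed_compl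
  obtain ⟨c, ⟨hc, hpc'⟩, hmin⟩ := (isCompact_Icc.of_isClosed_subset hclosed
    inter_subset_left).exists_isLeast ⟨b, right_mem_Icc.2 hsb, hpb⟩
  have hbefore : ∀ t ∈ Ico s c, p t ∈ coneInterior C := fun t ht => by
    by_contra h
    exact (hmin ⟨⟨ht.1, ht.2.le.trans hc.2⟩, h⟩).not_gt ht.2
  have hsc : s < c := hc.1.lt_of_ne fun h => hpc' (h ▸ hps)
  obtain ⟨v, hpv, hv⟩ := hp c hc
  have hderiv := hpv.hasDerivAt (Ici_mem_nhds hsc)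
  have hleft : ∀ᶠ t in 𝓝[<] c, p t ∈ coneInterior C :=
    mem_of_superset (Ico_mem_nhdsLT hsc) hbefore
  have hpcC : p c ∈ C := C.isClosed.mem_of_tendsto
    (hderiv.continuousAt.mono_left nhdsWithin_le_nhds) (hleft.mono fun _ => mem_of_mem_coneInterior)
  obtain ⟨ψ, hψ⟩ := exists_isSupportingFunctional hps hpcC hpc'
  have hslope := (hasDerivWithinAt_iff_tendsto_slope' self_notMem_Iio).1
    ((ψ.hasFDerivAt.comp_hasDerivAt c hderiv).hasDerivWithinAt (s := Iio c))
  refine (hv hpcC ψ hψ).not_ge (le_of_tendsto hslope ?_)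
  filter_upwards [hleft, self_mem_nhdsWithin] with t ht htc
  rw [slope_def_field, Function.comp_apply, Function.comp_apply, hψ.map_eq_zero, sub_zero]
  exact div_nonpos_of_nonneg_of_nonpos (hψ.pos _ ht).le (sub_nonpos.2 (le_of_lt htc))

theorem IsSubsolutionOn.sub_mem_coneInterior (hy : IsSubsolutionOn C φ U s b y)
    (hz : IsStrictSupersolutionOn C φ U s b z) (hqm : ∀ t ∈ Icc s b, IsQuasimonotoneOn C (φ t) U)
    (hsb : s ≤ b) (hs : z s - y s ∈ coneInterior C) : z b - y b ∈ coneInterior C := by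
  refine mem_coneInterior_of_forall_isSupportingFunctional (p := z - y) hsb hs fun t ht => ?_
  obtain ⟨hyU, v, hyv, hv⟩ := hy t ht
  obtain ⟨hzU, w, hzw, hw⟩ := hz t ht
  refine ⟨w - v, hzw.sub hyv, fun hyz ψ hψ => ?_⟩
  have hψyz : ψ (y t) = ψ (z t) :=
    (sub_eq_zero.1 (by simpa only [Pi.sub_apply, map_sub] using hψ.map_eq_zero)).symm
  have hφyz := hqm t ht _ hyU _ hzU hyz ψ hψ.nonneg hψyz
  have hψv := hψ.nonneg _ hv
  have hψw := hψ.pos _ hw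
  simp only [map_sub] at hψv hψw ⊢
  linarith

lemma IsRegularField.exists_coneLE_add_smul (hφ : IsRegularField φ D T) (hD : IsOpen D)
    (he : e ∈ coneInterior C) (hz : ContinuousOn z (Icc s b)) (hzD : MapsTo z (Icc s b) D)
    (hJ : Icc s b ⊆ timeInterval T) :
    ∃ δ > 0, ∃ K : ℝ, ∀ t ∈ Icc s b, ∀ w ∈ Icc 0 δ,
      ConeLE C (φ t (z t + w • e)) (φ t (z t) + (K * w) • e) := by
  obtain ⟨κ, hκ, hunit⟩ := exists_forall_coneLE_smul he
  have hcompact : IsCompact (z '' Icc s b) := isCompact_Icc.image_of_continuousOn hz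
  obtain ⟨δ, hδ, hthick⟩ := hcompact.exists_cthickening_subset_open hD hzD.image_subset
  obtain ⟨L, hL⟩ := hφ.bounded_fderiv _ hthick isClosed_cthickening
    hcompact.isBounded.cthickening
  refine ⟨δ / (‖e‖ + 1), by positivity, κ * (L * ‖e‖), fun t ht w hw => ?_⟩
  have hball : closedBall (z t) δ ⊆ cthickening δ (z '' Icc s b) :=
    closedBall_subset_cthickening (mem_image_of_mem z ht) δ
  have hnorm : ‖w • e‖ = w * ‖e‖ := by rw [norm_smul, Real.norm_of_nonneg hw.1]
  have hwδ : z t + w • e ∈ closedBall (z t) δ := by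
    rw [mem_closedBall_iff_norm, add_sub_cancel_left, hnorm]
    calc w * ‖e‖ ≤ w * (‖e‖ + 1) := by gcongr; exacts [hw.1, by simp]
      _ ≤ δ := (le_div_iff₀ (by positivity)).1 hw.2
  have hlip : ‖φ t (z t + w • e) - φ t (z t)‖ ≤ L * (w * ‖e‖) := by
    simpa [hnorm] using (convex_closedBall (z t) δ).norm_image_sub_le_of_norm_fderiv_le (𝕜 := ℝ)
      (fun x hx => hφ.differentiableAt t (hJ ht) x (hthick (hball hx)))
      (fun x hx => hL t (hJ ht) x (hball hx)) (mem_closedBall_self hδ.le) hwδ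
  have hle := (hunit (φ t (z t + w • e) - φ t (z t))).trans <|
    smul_coneLE_smul (mem_of_mem_coneInterior he) (mul_le_mul_of_nonneg_left hlip hκ.le)
  rw [ConeLE, sub_sub_eq_add_sub, add_comm] at hle
  rwa [ConeLE, show κ * (L * ‖e‖) * w = κ * (L * (w * ‖e‖)) by ring]

lemma hasDerivAt_mul_exp (a B s t : ℝ) :
    HasDerivAt (fun t => a * Real.exp (B * (t - s))) (B * (a * Real.exp (B * (t - s)))) t := by
  refine ((((hasDerivAt_id t).sub_const s).const_mul B).exp.const_mul a).congr_deriv ?_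
  rw [id]
  ring

theorem IsSupersolutionOn.eventually_isStrictSupersolutionOn
    (hz : IsSupersolutionOn C φ (coneInterior C) s b z) (hφ : IsRegularField φ (coneInterior C) T)
    (hJ : Icc s b ⊆ timeInterval T) (he : e ∈ coneInterior C) :
    ∃ B : ℝ, ∀ᶠ ε in 𝓝[>] 0, IsStrictSupersolutionOn C φ (coneInterior C) s b
      (fun t => z t + (ε * Real.exp (B * (t - s))) • e) := by
  obtain ⟨δ, hδ, K, hK⟩ := hφ.exists_coneLE_add_smul isOpen_coneInterior he hz.continuousOn
    (fun t ht => (hz t ht).1) hJ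
  refine ⟨K + 1, ?_⟩
  have hsmall : ∀ᶠ ε in 𝓝[>] 0, ε * Real.exp (|K + 1| * (b - s)) < δ :=
    nhdsWithin_le_nhds <| Continuous.tendsto (f := (· * Real.exp (|K + 1| * (b - s))))
      (by fun_prop) 0 |>.eventually_lt_const (by simpa using hδ)
  filter_upwards [hsmall, self_mem_nhdsWithin] with ε hεδ hε t ht
  rw [mem_Ioi] at hε
  obtain ⟨hzt, v, hzv, hv⟩ := hz t ht
  set w : ℝ → ℝ := fun t => ε * Real.exp ((K + 1) * (t - s))
  have hw : 0 < w t := by positivity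
  have hwδ : w t ≤ δ := by
    have hts := sub_nonneg.2 ht.1
    calc ε * Real.exp ((K + 1) * (t - s)) ≤ ε * Real.exp (|K + 1| * (b - s)) := by
          gcongr
          exacts [le_abs_self _, ht.2]
      _ ≤ δ := hεδ.le
  refine ⟨add_mem_coneInterior hzt (C.smul_mem (mem_of_mem_coneInterior he) hw.le), _,
    hzv.add ((hasDerivAt_mul_exp ε (K + 1) s t).smul_const e).hasDerivWithinAt, ?_⟩
  convert add_mem_coneInterior (smul_mem_coneInterior he hw)
    (C.add_mem hv (hK t ht (w t) ⟨hw.le, hwδ⟩)) using 1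
  module

theorem IsSubsolutionOn.coneLE (hy : IsSubsolutionOn C φ (coneInterior C) s b y)
    (hz : IsSupersolutionOn C φ (coneInterior C) s b z) (hφ : IsRegularField φ (coneInterior C) T)
    (hJ : Icc s b ⊆ timeInterval T)
    (hqm : ∀ t ∈ Icc s b, IsQuasimonotoneOn C (φ t) (coneInterior C)) (hsb : s ≤ b)
    (hs : ConeLE C (y s) (z s)) : ConeLE C (y b) (z b) := by
  have he := (hy s (left_mem_Icc.2 hsb)).1
  obtain ⟨B, hB⟩ := hz.eventually_isStrictSupersolutionOn hφ hJ he
  have hperturbed : ∀ᶠ ε in 𝓝[>] 0, z b + (ε * Real.exp (B * (b - s))) • y s - y b ∈ C := by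
    filter_upwards [hB, self_mem_nhdsWithin] with ε hzε hε
    refine mem_of_mem_coneInterior (hy.sub_mem_coneInterior hzε hqm hsb ?_)
    rw [add_sub_right_comm, add_comm]
    exact add_mem_coneInterior (smul_mem_coneInterior he (mul_pos hε (Real.exp_pos _))) hs
  have hlim : Tendsto (fun ε => z b + (ε * Real.exp (B * (b - s))) • y s - y b) (𝓝[>] 0)
      (𝓝 (z b - y b)) :=
    (Continuous.tendsto' (by fun_prop) _ _ (by simp)).mono_left nhdsWithin_le_nhds
  exact C.isClosed.mem_of_tendsto hlim hperturbed

theorem IsOrderPreservingOn.coneLE [CompleteSpace X]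
    (hmono : IsOrderPreservingOn C φ (coneInterior C) T (coneInterior C))
    (hφ : IsRegularField φ (coneInterior C) T) (hs : 0 ≤ s) (hbT : (b : EReal) < T)
    (hy : IsSubsolutionOn C φ (coneInterior C) s b y)
    (hz : IsSupersolutionOn C φ (coneInterior C) s b z) (hsb : s ≤ b)
    (hyz : ConeLE C (y s) (z s)) : ConeLE C (y b) (z b) :=
  have hJ := Icc_subset_timeInterval hs hbT
  hy.coneLE hz hφ hJ (fun _ ht => hmono.isQuasimonotoneOn hφ isOpen_coneInterior (hJ ht)) hsb hyz

end Comparison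

/-! ### Contraction of Thompson's metric -/

section Contraction

variable {C : ProperCone ℝ X} {φ : ℝ → X → X} {T c : EReal} {α s t b r : ℝ} {x₀ x₁ x₂ : X}
  {x : ℝ → X}

theorem IsSolution.isSupersolutionOn_exp_smul (hx : IsSolution φ (coneInterior C) s x₀ c x)
    (hφ : IsRegularField φ (coneInterior C) T)
    (h : InfinitesimalContraction C φ T (coneInterior C) α) (hs : 0 ≤ s) (hbc : (b : EReal) < c)
    (hbT : (b : EReal) < T) (hr : 0 ≤ r) :
    IsSupersolutionOn C φ (coneInterior C) s b
      (fun t => Real.exp (r * Real.exp (-α * (t - s))) • x t) := by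
  intro t ht
  obtain ⟨hxt, hderiv⟩ := hx.2 t ht.1 ((EReal.coe_le_coe_iff.2 ht.2).trans_lt hbc)
  refine ⟨smul_mem_coneInterior hxt (Real.exp_pos _), _,
    (hasDerivAt_mul_exp r (-α) s t).exp.hasDerivWithinAt.smul hderiv, ?_⟩
  refine coneLE_of_radialField_coneLE (ε := 0)
    (h.radialField_coneLE hφ (Icc_subset_timeInterval hs hbT ht) hxt (by positivity))
    (mem_of_mem_coneInterior hxt) (by simp) (by simp [ConeLE])

variable [CompleteSpace X]

theorem InfinitesimalContraction.flow_coneLE_exp_smul_flow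
    (h : InfinitesimalContraction C φ T (coneInterior C) α)
    (hφ : IsRegularField φ (coneInterior C) T)
    (hmono : IsOrderPreservingOn C φ (coneInterior C) T (coneInterior C)) (hs : 0 ≤ s)
    (hst : s ≤ t) (ht₁ : (t : EReal) < maxTime φ (coneInterior C) T s x₁)
    (ht₂ : (t : EReal) < maxTime φ (coneInterior C) T s x₂) (hr : 0 ≤ r)
    (hle : ConeLE C x₁ (Real.exp r • x₂)) :
    ConeLE C (flow φ (coneInterior C) T s t x₁)
      (Real.exp (Real.exp (-α * (t - s)) * r) • flow φ (coneInterior C) T s t x₂) := by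
  have htT := ht₁.trans_le maxTime_le
  have hflow (x) := isSolution_flow (x₀ := x) hφ isOpen_coneInterior hs
  have hsub := (hflow x₁).isSubsolutionOn (C := C) ht₁
  have hsuper := (hflow x₂).isSupersolutionOn_exp_smul hφ h hs ht₂ htT hr
  rw [mul_comm]
  exact hmono.coneLE hφ hs htT hsub hsuper hst (by simpa [flow_self] using hle)

theorem InfinitesimalContraction.contractsThompson
    (h : InfinitesimalContraction C φ T (coneInterior C) α)
    (hφ : IsRegularField φ (coneInterior C) T)
    (hmono : IsOrderPreservingOn C φ (coneInterior C) T (coneInterior C)) :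
    ContractsThompson C φ (coneInterior C) T (coneInterior C) α := by
  intro x₁ hx₁ x₂ hx₂ s t hs hst ht
  obtain rfl | hC := eq_or_ne C ⊤
  · simp [thompsonDist_top]
  have hsT : s ∈ timeInterval T := ⟨hs, (EReal.coe_le_coe_iff.2 hst).trans_lt
    ((lt_min_iff.1 ht).1.trans_le (exitTime_le _))⟩
  rw [exitTime_eq_maxTime hφ isOpen_coneInterior hsT hx₁,
    exitTime_eq_maxTime hφ isOpen_coneInterior hsT hx₂, lt_min_iff] at ht
  have hflow (x) := (isSolution_flow (x₀ := x) hφ isOpen_coneInterior hs).2 t hst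
  have hr := thompsonDist_nonneg hC hx₁ hx₂
  obtain ⟨h₁₂, h₂₁⟩ := (thompsonDist_le_iff hC hx₁ hx₂).1 le_rfl
  exact (thompsonDist_le_iff hC (hflow x₁ ht.1).1 (hflow x₂ ht.2).1).2
    ⟨h.flow_coneLE_exp_smul_flow hφ hmono hs hst ht.1 ht.2 hr h₁₂,
      h.flow_coneLE_exp_smul_flow hφ hmono hs hst ht.2 ht.1 hr h₂₁⟩

theorem ContractsThompson.eventually_flow_exp_smul_coneLE
    (h : ContractsThompson C φ (coneInterior C) T (coneInterior C) α) (hC : C ≠ ⊤)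
    (hφ : IsRegularField φ (coneInterior C) T) (hs : s ∈ timeInterval T)
    (hx : x₀ ∈ coneInterior C) (hr : 0 ≤ r) :
    ∀ᶠ t in 𝓝[>] s, ConeLE C (flow φ (coneInterior C) T s t (Real.exp r • x₀))
      (Real.exp (r * Real.exp (-α * (t - s))) • flow φ (coneInterior C) T s t x₀) := by
  have hx' : Real.exp r • x₀ ∈ coneInterior C := smul_mem_coneInterior hx (Real.exp_pos r)
  filter_upwards [eventually_lt_min_exitTime hφ isOpen_coneInterior hs hx' hx] with t ht
  have hdist := (h _ hx' x₀ hx s t hs.1 ht.1.le ht.2).trans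
    (mul_le_mul_of_nonneg_left (thompsonDist_exp_smul_self_le hC hx hr) (Real.exp_pos _).le)
  rw [exitTime_eq_maxTime hφ isOpen_coneInterior hs hx,
    exitTime_eq_maxTime hφ isOpen_coneInterior hs hx', lt_min_iff] at ht
  have hflow (x) := (isSolution_flow (x₀ := x) hφ isOpen_coneInterior hs.1).2 t ht.1.le
  rw [mul_comm]
  exact ((thompsonDist_le_iff hC (hflow _ ht.2.1).1 (hflow _ ht.2.2).1).1 hdist).1

-- The bound `M_s^t(eʳ x) ≤ e^{ρ(t)} M_s^t(x)`, with `ρ(t) = r e^{-α(t-s)}`, is an equality at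
-- `t = s`; comparing the velocities there gives `φ(s, eʳ x) ≤ eʳ (φ(s, x) - α r x)`.
theorem ContractsThompson.infinitesimalContraction
    (h : ContractsThompson C φ (coneInterior C) T (coneInterior C) α)
    (hφ : IsRegularField φ (coneInterior C) T) :
    InfinitesimalContraction C φ T (coneInterior C) α := by
  obtain rfl | hC := eq_or_ne C ⊤
  · exact fun _ _ _ _ => trivial
  refine infinitesimalContraction_of_radialField_coneLE hφ fun s hs x hx r hr => ?_
  have hvel {y : X} (hy : y ∈ coneInterior C) :=
    hasDerivWithinAt_flow_self hφ isOpen_coneInterior hs hy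
  have hscaled := (hasDerivAt_mul_exp r (-α) s s).exp.hasDerivWithinAt.smul (hvel hx)
  have hmem := mem_of_hasDerivWithinAt
    (hscaled.sub (hvel (smul_mem_coneInterior hx (Real.exp_pos r)))) (by simp [flow_self])
    (h.eventually_flow_exp_smul_coneLE hC hφ hs hx hr.le)
  have hsmul := C.smul_mem hmem (Real.exp_pos (-r)).le
  simp only [sub_self, mul_zero, Real.exp_zero, mul_one, flow_self] at hsmul
  rw [ConeLE, radialField]
  convert hsmul using 1
  rw [Real.exp_neg]
  match_scalars <;> field_simp

end Contraction

/-! ### Invariance of the interior -/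

section Invariance

variable {C : ProperCone ℝ X} {φ : ℝ → X → X} {T : EReal} {α B s a b c t : ℝ} {u v x₀ : X}
  {x : ℝ → X}

/-- The order interval `[u, v]` with respect to the cone `C`. -/
def orderInterval (C : ProperCone ℝ X) (u v : X) : Set X := {w | ConeLE C u w ∧ ConeLE C w v}

lemma orderInterval_subset_coneInterior (hu : u ∈ coneInterior C) :
    orderInterval C u v ⊆ coneInterior C := fun _ hw => hw.1.mem_coneInterior hu

lemma isClosed_orderInterval : IsClosed (orderInterval C u v) :=
  (C.isClosed.preimage (f := fun w => w - u) (by fun_prop)).inter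
    (C.isClosed.preimage (f := fun w => v - w) (by fun_prop))

lemma convex_orderInterval : Convex ℝ (orderInterval C u v) :=
  (C.convex.affine_preimage (AffineMap.id ℝ X - AffineMap.const ℝ X u)).inter
    (C.convex.affine_preimage (AffineMap.const ℝ X v - AffineMap.id ℝ X))

lemma IsNormalCone.isBounded_orderInterval (hN : IsNormalCone C) (hu : u ∈ C) :
    Bornology.IsBounded (orderInterval C u v) := by
  obtain ⟨γ, hγ⟩ := hN
  have hu' : ConeLE C 0 u := by simpa [ConeLE] using hu
  exact isBounded_iff_forall_norm_le.2 ⟨γ * ‖v‖, fun w hw => hγ w v (hu'.trans hw.1) hw.2⟩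

lemma IsRegularField.exists_coneLE_smul (hφ : IsRegularField φ (coneInterior C) T)
    (hx₀ : x₀ ∈ coneInterior C) (hJ : Icc s b ⊆ timeInterval T) :
    ∃ c : ℝ, 0 ≤ c ∧ ∀ t ∈ Icc s b, ConeLE C (φ t x₀) (c • x₀) ∧ ConeLE C (-φ t x₀) (c • x₀) := by
  obtain ⟨κ, hκ, hunit⟩ := exists_forall_coneLE_smul hx₀
  obtain ⟨M, hM⟩ := isCompact_Icc.exists_bound_of_continuousOn
    ((hφ.continuousOn_time hx₀).mono hJ)
  refine ⟨κ * |M|, by positivity, fun t ht => ?_⟩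
  have hle : ConeLE C ((κ * ‖φ t x₀‖) • x₀) ((κ * |M|) • x₀) :=
    smul_coneLE_smul (mem_of_mem_coneInterior hx₀)
      (mul_le_mul_of_nonneg_left ((hM t ht).trans (le_abs_self M)) hκ.le)
  exact ⟨(hunit _).trans hle, by simpa using (hunit (-φ t x₀)).trans (by simpa using hle)⟩

-- `ρ(t) = c e^{B(t-s)}` satisfies `ρ' + α ρ = (B + α) ρ ≥ c`, which absorbs `φ(t, x₀) ≤ c x₀`.
lemma le_add_mul_mul_exp (hc : 0 ≤ c) (hB : 0 ≤ B) (hBα : 1 ≤ B + α) (hst : s ≤ t) :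
    c ≤ B * (c * Real.exp (B * (t - s))) + α * (c * Real.exp (B * (t - s))) := by
  rw [← add_mul]
  have h : c ≤ c * Real.exp (B * (t - s)) :=
    le_mul_of_one_le_right hc (Real.one_le_exp (mul_nonneg hB (sub_nonneg.2 hst)))
  exact h.trans (le_mul_of_one_le_left (hc.trans h) hBα)

namespace InfinitesimalContraction

theorem isSupersolutionOn_exp_smul_const
    (h : InfinitesimalContraction C φ T (coneInterior C) α)
    (hφ : IsRegularField φ (coneInterior C) T) (hJ : Icc s b ⊆ timeInterval T)
    (hx₀ : x₀ ∈ coneInterior C) (hc : 0 ≤ c) (hB : 0 ≤ B) (hBα : 1 ≤ B + α)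
    (hle : ∀ t ∈ Icc s b, ConeLE C (φ t x₀) (c • x₀)) :
    IsSupersolutionOn C φ (coneInterior C) s b
      (fun t => Real.exp (c * Real.exp (B * (t - s))) • x₀) := by
  intro t ht
  refine ⟨smul_mem_coneInterior hx₀ (Real.exp_pos _), _,
    ((hasDerivAt_mul_exp c B s t).exp.smul_const x₀).hasDerivWithinAt, ?_⟩
  simpa using coneLE_of_radialField_coneLE (v := 0)
    (h.radialField_coneLE hφ (hJ ht) hx₀ (by positivity)) (mem_of_mem_coneInterior hx₀)
    (le_add_mul_mul_exp hc hB hBα ht.1) (by simpa using hle t ht)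

theorem isSubsolutionOn_exp_neg_smul_const
    (h : InfinitesimalContraction C φ T (coneInterior C) α)
    (hφ : IsRegularField φ (coneInterior C) T) (hJ : Icc s b ⊆ timeInterval T)
    (hx₀ : x₀ ∈ coneInterior C) (hc : 0 ≤ c) (hB : 0 ≤ B) (hBα : 1 ≤ B + α)
    (hle : ∀ t ∈ Icc s b, ConeLE C (-φ t x₀) (c • x₀)) :
    IsSubsolutionOn C φ (coneInterior C) s b
      (fun t => Real.exp (-(c * Real.exp (B * (t - s)))) • x₀) := by
  intro t ht
  have hmem {r : ℝ} : Real.exp r • x₀ ∈ coneInterior C := smul_mem_coneInterior hx₀ (Real.exp_pos r)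
  refine ⟨hmem, _, ((hasDerivAt_mul_exp c B s t).neg.exp.smul_const x₀).hasDerivWithinAt, ?_⟩
  simpa using coneLE_of_radialField_neg_coneLE (v := 0)
    (h.radialField_coneLE hφ (hJ ht) hmem (by positivity)) (mem_of_mem_coneInterior hx₀)
    (le_add_mul_mul_exp hc hB hBα ht.1) (by simpa [ConeLE, add_comm] using hle t ht)

variable [CompleteSpace X]

theorem exists_forall_mem_orderInterval
    (h : InfinitesimalContraction C φ T (coneInterior C) α)
    (hφ : IsRegularField φ (coneInterior C) T)
    (hmono : IsOrderPreservingOn C φ (coneInterior C) T (coneInterior C))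
    (hx : IsSolution φ (coneInterior C) s x₀ a x) (hs : 0 ≤ s) (hx₀ : x₀ ∈ coneInterior C)
    (haT : (a : EReal) < T) :
    ∃ R, ∀ t ∈ Ico s a, x t ∈ orderInterval C (Real.exp (-R) • x₀) (Real.exp R • x₀) := by
  obtain ⟨c, hc, hle⟩ := hφ.exists_coneLE_smul hx₀ (Icc_subset_timeInterval hs haT)
  have hB : 0 ≤ |α| + 1 := by positivity
  have hBα : 1 ≤ |α| + 1 + α := by linarith [neg_abs_le α]
  have hx₀C : x₀ ∈ C := mem_of_mem_coneInterior hx₀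
  refine ⟨c * Real.exp ((|α| + 1) * (a - s)), fun t ht => ?_⟩
  have hta : (t : EReal) < a := EReal.coe_lt_coe_iff.2 ht.2
  have htT := hta.trans haT
  have hJ := Icc_subset_timeInterval hs htT
  have hle' {τ} (hτ : τ ∈ Icc s t) := hle τ (Icc_subset_Icc_right ht.2.le hτ)
  have hlower := hmono.coneLE hφ hs htT (h.isSubsolutionOn_exp_neg_smul_const hφ hJ hx₀ hc hB hBα
    fun τ hτ => (hle' hτ).2) (hx.isSupersolutionOn hta) ht.1
      (by simpa [hx.1] using smul_coneLE_smul hx₀C (Real.exp_le_one_iff.2 (neg_nonpos.2 hc)))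
  have hupper := hmono.coneLE hφ hs htT (hx.isSubsolutionOn hta)
    (h.isSupersolutionOn_exp_smul_const hφ hJ hx₀ hc hB hBα fun τ hτ => (hle' hτ).1) ht.1
      (by simpa [hx.1] using smul_coneLE_smul hx₀C (Real.one_le_exp hc))
  have hbound : c * Real.exp ((|α| + 1) * (t - s)) ≤ c * Real.exp ((|α| + 1) * (a - s)) := by
    gcongr
    exact ht.2.le
  exact ⟨(smul_coneLE_smul hx₀C (Real.exp_le_exp.2 (neg_le_neg hbound))).trans hlower,
    hupper.trans (smul_coneLE_smul hx₀C (Real.exp_le_exp.2 hbound))⟩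

theorem maxTime_eq (h : InfinitesimalContraction C φ T (coneInterior C) α)
    (hφ : IsRegularField φ (coneInterior C) T)
    (hmono : IsOrderPreservingOn C φ (coneInterior C) T (coneInterior C)) (hN : IsNormalCone C)
    (hs : s ∈ timeInterval T) (hx₀ : x₀ ∈ coneInterior C) :
    maxTime φ (coneInterior C) T s x₀ = T := by
  refine maxTime_le.eq_of_not_lt fun hlt => ?_
  have hs' := lt_maxTime hφ isOpen_coneInterior hs hx₀
  have hflow := isSolution_flow (x₀ := x₀) hφ isOpen_coneInterior hs.1
  obtain ⟨a, ha⟩ : ∃ a : ℝ, (a : EReal) = maxTime φ (coneInterior C) T s x₀ :=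
    ⟨_, EReal.coe_toReal hlt.ne_top hs'.ne_bot⟩
  rw [← ha] at hlt hs' hflow
  obtain ⟨R, hR⟩ := h.exists_forall_mem_orderInterval hφ hmono hflow hs.1 hx₀ hlt
  have hlow : Real.exp (-R) • x₀ ∈ coneInterior C := smul_mem_coneInterior hx₀ (Real.exp_pos _)
  exact (hflow.lt_maxTime_of_forall_mem hφ isOpen_coneInterior hs.1 (EReal.coe_lt_coe_iff.1 hs')
    hlt (orderInterval_subset_coneInterior hlow) isClosed_orderInterval
    (hN.isBounded_orderInterval (mem_of_mem_coneInterior hlow)) convex_orderInterval hR).ne ha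

end InfinitesimalContraction

end Invariance

end ConeFlow

theorem mainTheorem6_general {X : Type*} [NormedAddCommGroup X] [NormedSpace ℝ X] [CompleteSpace X]
    (C : ProperCone ℝ X) (T : EReal) (φ : ℝ → X → X)
    (hφ : ConeFlow.IsRegularField φ (ConeFlow.coneInterior C) T) (α : ℝ)
    (hmono : ConeFlow.IsOrderPreservingOn C φ (ConeFlow.coneInterior C) T
      (ConeFlow.coneInterior C)) :
    (ConeFlow.ContractsThompson C φ (ConeFlow.coneInterior C) T (ConeFlow.coneInterior C) α ↔
      ConeFlow.InfinitesimalContraction C φ T (ConeFlow.coneInterior C) α) ∧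
    (ConeFlow.IsNormalCone C →
      (ConeFlow.ContractsThompson C φ (ConeFlow.coneInterior C) T (ConeFlow.coneInterior C) α ∨
        ConeFlow.InfinitesimalContraction C φ T (ConeFlow.coneInterior C) α) →
      ∀ s ∈ ConeFlow.timeInterval T, ∀ x ∈ ConeFlow.coneInterior C,
        ConeFlow.exitTime φ (ConeFlow.coneInterior C) T (ConeFlow.coneInterior C) s x = T) := by
  refine ⟨⟨fun h => h.infinitesimalContraction hφ, fun h => h.contractsThompson hφ hmono⟩,
    fun hN h s hs x hx => ?_⟩
  have hinf := h.elim (fun h => h.infinitesimalContraction hφ) id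
  rw [ConeFlow.exitTime_eq_maxTime hφ ConeFlow.isOpen_coneInterior hs hx]
  exact hinf.maxTime_eq hφ hmono hN hs hx

theorem mainTheorem6 {X : Type*} [NormedAddCommGroup X] [NormedSpace ℝ X] [CompleteSpace X]
    (C : ProperCone ℝ X) (hC : ConeFlow.IsPointed C)
    (T : EReal) (hT : 0 < T) (φ : ℝ → X → X)
    (hφ : ConeFlow.IsRegularField φ (ConeFlow.coneInterior C) T) (α : ℝ)
    (hmono : ConeFlow.IsOrderPreservingOn C φ (ConeFlow.coneInterior C) T
      (ConeFlow.coneInterior C)) :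
    (ConeFlow.ContractsThompson C φ (ConeFlow.coneInterior C) T (ConeFlow.coneInterior C) α ↔
      ConeFlow.InfinitesimalContraction C φ T (ConeFlow.coneInterior C) α) ∧
    (ConeFlow.IsNormalCone C →
      (ConeFlow.ContractsThompson C φ (ConeFlow.coneInterior C) T (ConeFlow.coneInterior C) α ∨
        ConeFlow.InfinitesimalContraction C φ T (ConeFlow.coneInterior C) α) →
      ∀ s ∈ ConeFlow.timeInterval T, ∀ x ∈ ConeFlow.coneInterior C,
        ConeFlow.exitTime φ (ConeFlow.coneInterior C) T (ConeFlow.coneInterior C) s x = T) := by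
  exact mainTheorem6_general C T φ hφ α hmono
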